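/- Let $\mathbb S^2\subset\mathbb R^3$ be the unit sphere with its surface measure $d\omega$ normalized so that $\int_{\mathbb S^2}d\omega=1$, let $\nabla$ and $\Delta$ be the gradient and the Laplace–Beltrami operator of $\mathbb S^2$, let $\alpha>0$, and let $$I_\alpha(u)=\alpha\int_{\mathbb S^2}|\nabla u|^2\,d\omega+2\int_{\mathbb S^2}u\,d\omega-\tfrac12\log\Big[\Big(\int_{\mathbb S^2}e^{2u}\,d\omega\Big)^2-\sum_{i=1}^3\Big(\int_{\mathbb S^2}e^{2u}x_i\,d\omega\Big)^2\Big],\qquad \mathcal H=\Big\{u\in H^1(\mathbb S^2):\int_{\mathbb S^2}e^{2u}\,d\omega=1\Big\}.$$ For $u\in\mathcal H$ put $a_i=\int_{\mathbb S^2}e^{2u}x_i\,d\omega$ $(i=1,2,3)$. Call $u\in\mathcal H$ a critical point of $I_\alpha$ in $\mathcal H$ if $\frac{d}{dt}\big|_{t=0}I_\alpha(u+\gamma(t,\cdot))$ exists and equals $0$ for every $\gamma\in C^\infty(\mathbb R\times\mathbb S^2)$ with $\gamma(0,\cdot)=0$ and $u+\gamma(t,\cdot)\in\mathcal H$ for all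 $t$. Then for every $u\in\mathcal H$ one has $\sum_{i=1}^3a_i^2<1$, and $u$ is a critical point of $I_\alpha$ in $\mathcal H$ if and only if $u$ is a weak solution of $$\alpha\Delta u+\frac{1-\sum_{i=1}^3a_ix_i}{1-\sum_{i=1}^3a_i^2}\,e^{2u}-1=0\quad\text{on }\mathbb S^2,$$ that is, $$-\alpha\int_{\mathbb S^2}\nabla u\cdot\nabla\varphi\,d\omega+\int_{\mathbb S^2}\Big(\frac{1-\sum_i a_ix_i}{1-\sum_i a_i^2}\,e^{2u}-1\Big)\varphi\,d\omega=0\quad\text{for all }\varphi\in C^\infty(\mathbb S^2).$$ If moreover $u\in C^2(\mathbb S^2)$, then $u$ is a critical point of $I_\alpha$ in $\mathcal H$ if and only if the equation holds at every point of $\mathbb S^2$. -/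

import Mathlib

open MeasureTheory Set Metric
open scoped Manifold ContDiff RealInnerProductSpace

noncomputable section

/-- Euclidean three-space. -/
abbrev E3 : Type := EuclideanSpace ℝ (Fin 3)

/-- The unit sphere `𝕊²` in `ℝ³`, with Mathlib's structure of a smooth surface. -/
abbrev S2 : Type := sphere (0 : E3) 1

instance factFinrankE3 : Fact (Module.finrank ℝ E3 = 2 + 1) := ⟨by simp⟩

/-- The normalized surface measure `dω` on `𝕊²`, of total mass one. -/
def omega : Measure S2 :=
  ((volume : Measure E3).toSphere univ)⁻¹ • (volume : Measure E3).toSphere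

instance omegaIsProbabilityMeasure : IsProbabilityMeasure omega := by
  refine ⟨?_⟩
  rw [omega, Measure.smul_apply, smul_eq_mul]
  refine ENNReal.inv_mul_cancel ?_ (measure_ne_top _ _)
  exact (Measure.measure_univ_ne_zero).mpr (Measure.toSphere_ne_zero _)

/-- The extension of `f` to `ℝ³` that is constant on open rays from the origin. -/
def radialExt {F : Type*} [Zero F] (f : S2 → F) (y : E3) : F :=
  if h : y = 0 then 0
  else f ⟨‖y‖⁻¹ • y, by
    rw [mem_sphere_zero_iff_norm, norm_smul, norm_inv, norm_norm,
      inv_mul_cancel₀ (norm_ne_zero_iff.mpr h)]⟩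

/-- The gradient `∇f` of a differentiable function on `𝕊²`, as a vector of `ℝ³` tangent to `𝕊²`:
the Euclidean gradient at `x` of the extension that is constant along rays. -/
def sphGrad (f : S2 → ℝ) (x : S2) : E3 := gradient (radialExt f) (x : E3)

/-- The divergence on `𝕊²` of a differentiable tangent field `X` (viewed as a map into `ℝ³`).
The extension is constant along rays, so the trace only sees tangential derivatives. -/
def sphDiv (X : S2 → E3) (x : S2) : ℝ :=
  LinearMap.trace ℝ E3 (fderiv ℝ (radialExt X) (x : E3) : E3 →ₗ[ℝ] E3)

/-- The Laplace–Beltrami operator of `𝕊²` on twice differentiable functions: the Euclidean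
Laplacian, on `𝕊²`, of the extension that is constant along rays. -/
def sphLaplacian (f : S2 → ℝ) (x : S2) : ℝ := Laplacian.laplacian (radialExt f) (x : E3)

/-- Smooth real functions on `𝕊²`. -/
def IsSmooth (φ : S2 → ℝ) : Prop := ContMDiff (𝓡 2) 𝓘(ℝ, ℝ) ∞ φ

/-- Smooth tangent vector fields on `𝕊²`. -/
def IsSmoothTangentField (X : S2 → E3) : Prop :=
  ContMDiff (𝓡 2) 𝓘(ℝ, E3) ∞ X ∧ ∀ x, ⟪X x, (x : E3)⟫ = 0

/-- `G` is a square integrable weak gradient of `u` on `𝕊²`: a tangent field in `L²` with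
`∫ ⟨G, X⟩ dω = - ∫ u div X dω` for every smooth tangent field `X`. -/
structure IsWeakGrad (u : S2 → ℝ) (G : S2 → E3) : Prop where
  memLp : MemLp G 2 omega
  tangent : ∀ᵐ x ∂omega, ⟪G x, (x : E3)⟫ = 0
  integral_eq : ∀ X : S2 → E3, IsSmoothTangentField X →
    ∫ x, ⟪G x, X x⟫ ∂omega = - ∫ x, u x * sphDiv X x ∂omega

/-- The Sobolev space `H¹(𝕊²)`: `u` and its weak gradient are in `L²`. -/
def MemH1 (u : S2 → ℝ) : Prop := MemLp u 2 omega ∧ ∃ G, IsWeakGrad u G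

open Classical in
/-- The weak gradient of `u ∈ H¹(𝕊²)` (well defined almost everywhere; zero outside `H¹`). -/
def weakGrad (u : S2 → ℝ) : S2 → E3 :=
  if h : ∃ G, IsWeakGrad u G then h.choose else 0

/-- The moments `a_i = ∫ e^{2u} x_i dω`. -/
def moment (u : S2 → ℝ) (i : Fin 3) : ℝ :=
  ∫ x, Real.exp (2 * u x) * (x : E3) i ∂omega

/-- The functional `I_α`. -/
def functionalI (α : ℝ) (u : S2 → ℝ) : ℝ :=
  α * (∫ x, ‖weakGrad u x‖ ^ 2 ∂omega) + 2 * (∫ x, u x ∂omega)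
    - 1 / 2 * Real.log ((∫ x, Real.exp (2 * u x) ∂omega) ^ 2 - ∑ i, moment u i ^ 2)

/-- The normalized class `𝓗 = {u ∈ H¹(𝕊²) : ∫ e^{2u} dω = 1}` (as the integral is nonzero,
`e^{2u}` is integrable for its members). -/
def classH : Set (S2 → ℝ) :=
  {u | MemH1 u ∧ ∫ x, Real.exp (2 * u x) ∂omega = 1}

/-- A smooth variation of `u` inside `𝓗`: a smooth family `u + γ(t, ·) ∈ 𝓗` with `γ(0, ·) = 0`. -/
structure IsVariationInH (u : S2 → ℝ) (γ : ℝ → S2 → ℝ) : Prop where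
  smooth : ContMDiff (𝓘(ℝ, ℝ).prod (𝓡 2)) 𝓘(ℝ, ℝ) ∞ (fun p : ℝ × S2 => γ p.1 p.2)
  zero : ∀ x, γ 0 x = 0
  mem : ∀ t, (fun x => u x + γ t x) ∈ classH

/-- `u` is a critical point of `I_α` in `𝓗`: the first variation of `I_α` at `u` exists and
vanishes along every smooth variation of `u` inside `𝓗`. -/
def IsCriticalInH (α : ℝ) (u : S2 → ℝ) : Prop :=
  ∀ γ : ℝ → S2 → ℝ, IsVariationInH u γ →
    HasDerivAt (fun t : ℝ => functionalI α (fun x => u x + γ t x)) 0 0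

/-- The term `(1 - ∑ a_i x_i) / (1 - ∑ a_i²) · e^{2u} - 1` with `a_i = ∫ e^{2u} x_i dω`. -/
def eulerTerm (u : S2 → ℝ) (x : S2) : ℝ :=
  (1 - ∑ i, moment u i * (x : E3) i) / (1 - ∑ i, moment u i ^ 2) * Real.exp (2 * u x) - 1

/-- `u ∈ H¹(𝕊²)` is a weak solution of
`α Δu + (1 - ∑ a_i x_i) / (1 - ∑ a_i²) · e^{2u} - 1 = 0` on `𝕊²`. -/
def IsWeakSolution (α : ℝ) (u : S2 → ℝ) : Prop :=
  ∀ φ : S2 → ℝ, IsSmooth φ →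
    -(α * ∫ x, ⟪weakGrad u x, sphGrad φ x⟫ ∂omega) + (∫ x, eulerTerm u x * φ x ∂omega) = 0

/-- `u` solves the equation pointwise on `𝕊²` (meant for `u` of class `C²`). -/
def IsClassicalSolution (α : ℝ) (u : S2 → ℝ) : Prop :=
  ∀ x : S2, α * sphLaplacian u x + eulerTerm u x = 0

end

/-!
Along a variation `u + γ(t, ·)` inside `𝓗` with velocity `φ = ∂ₜγ(0, ·)`, the normalization
`∫ e^{2u + 2γ} = 1` forces `∫ e^{2u} φ = 0`, and under this constraint the derivative of `I_α` at
`t = 0` is `-2` times the weak form of the equation tested with `φ`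
(`hasDerivAt_functionalI`). Hence weak solutions are critical points. Conversely the weak form
vanishes on constants (`weakForm_sub_const`), while every smooth `φ` is, up to a constant, the
velocity of the variation `t φ - ½ log ∫ e^{2u + 2tφ}` (`isVariationInH_normalized`); its
smoothness in `t` is the analyticity of a cumulant generating function. The logarithm in `I_α` is
harmless because the center of mass of `e^{2u} dω` lies in the open unit ball
(`sum_moment_sq_lt_one`).

The Dirichlet term is expanded through `∇(u + γ) = ∇u + ∇γ` almost everywhere, where the weak
gradient of `u` is only square integrable. This needs the uniqueness of weak gradients
(`IsWeakGrad.ae_eq`) and the divergence theorem on the sphere (`integral_inner_sphGrad_field`),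
which also turns the weak form into the pointwise equation when `u` is of class `C²`. This theorem
reduces to `∫ ⟨∇g, v⟩ = 2 ∫ g ⟨x, v⟩` for constant vectors `v`
(`integral_inner_sphGrad_toSphere`). That formula is integration by parts in `ℝ³` for the extension
of `g` constant along rays, multiplied by a radial cutoff and evaluated in polar coordinates.
-/

/-! ### Radial extension of functions on the sphere -/

/-- The radial projection `y ↦ y / ‖y‖` onto the sphere (with an arbitrary value at the origin). -/
noncomputable def radialProj (y : E3) : S2 :=
  if h : y = 0 then ⟨EuclideanSpace.single 0 1, by simp⟩
  else ⟨‖y‖⁻¹ • y, by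
    rw [mem_sphere_zero_iff_norm, norm_smul, norm_inv, norm_norm,
      inv_mul_cancel₀ (norm_ne_zero_iff.mpr h)]⟩

lemma coe_radialProj {y : E3} (hy : y ≠ 0) : (radialProj y : E3) = ‖y‖⁻¹ • y := by
  simp [radialProj, hy]

@[simp] lemma radialProj_coe (x : S2) : radialProj (x : E3) = x := by
  ext1
  rw [coe_radialProj (ne_zero_of_mem_unit_sphere x)]
  simp

lemma radialProj_smul {r : ℝ} (hr : 0 < r) (y : E3) (hy : y ≠ 0) :
    radialProj (r • y) = radialProj y := by
  ext1
  rw [coe_radialProj hy, coe_radialProj (smul_ne_zero hr.ne' hy), norm_smul,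
    Real.norm_of_nonneg hr.le, smul_smul, mul_inv]
  congr 1
  field_simp

lemma radialExt_eq {F : Type*} [Zero F] (f : S2 → F) {y : E3} (hy : y ≠ 0) :
    radialExt f y = f (radialProj y) := by
  simp [radialExt, radialProj, hy]

@[simp] lemma radialExt_coe {F : Type*} [Zero F] (f : S2 → F) (x : S2) :
    radialExt f (x : E3) = f x := by
  rw [radialExt_eq f (ne_zero_of_mem_unit_sphere x), radialProj_coe]

lemma radialExt_eventuallyEq {F : Type*} [Zero F] (f : S2 → F) {y : E3} (hy : y ≠ 0) :
    radialExt f =ᶠ[nhds y] fun z => f (radialProj z) := by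
  filter_upwards [isOpen_ne.mem_nhds hy] with z hz using radialExt_eq f hz

lemma contMDiffAt_radialProj {n : ℕ∞ω} {y : E3} (hy : y ≠ 0) :
    ContMDiffAt 𝓘(ℝ, E3) (𝓡 2) n radialProj y := by
  let U : TopologicalSpace.Opens E3 := ⟨{y | y ≠ 0}, isOpen_ne⟩
  have key : ContMDiff 𝓘(ℝ, E3) (𝓡 2) n (fun z : U => radialProj z) := by
    have h1 : ContMDiff 𝓘(ℝ, E3) 𝓘(ℝ, E3) n (fun z : U => ‖(z : E3)‖⁻¹ • (z : E3)) := by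
      intro z
      have h2 : ContDiffAt ℝ n (fun y : E3 => ‖y‖⁻¹ • y) (z : E3) :=
        ((contDiffAt_norm ℝ z.2).inv (norm_ne_zero_iff.mpr z.2)).smul contDiffAt_id
      exact contMDiffAt_subtype_iff.2 h2.contMDiffAt
    have h3 := h1.codRestrict_sphere (n := 2) (fun z => by
      rw [← coe_radialProj z.2]; exact (radialProj (z : E3)).2)
    have h4 : (fun z : U => radialProj z) = Set.codRestrict (fun z : U => ‖(z : E3)‖⁻¹ • (z : E3)) _
        (fun z => by rw [← coe_radialProj z.2]; exact (radialProj (z : E3)).2) := by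
      ext1 z
      ext1
      exact coe_radialProj z.2
    rw [h4]
    exact h3
  exact contMDiffAt_subtype_iff.1 (key ⟨y, hy⟩)

section
variable {F : Type*} [NormedAddCommGroup F] [NormedSpace ℝ F]

lemma contDiffAt_radialExt {n : ℕ∞ω} {f : S2 → F} (hf : ContMDiff (𝓡 2) 𝓘(ℝ, F) n f) {y : E3}
    (hy : y ≠ 0) : ContDiffAt ℝ n (radialExt f) y := by
  have h : ContMDiffAt 𝓘(ℝ, E3) 𝓘(ℝ, F) n (f ∘ radialProj) y :=
    (hf _).comp y (contMDiffAt_radialProj hy)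
  exact h.contDiffAt.congr_of_eventuallyEq (radialExt_eventuallyEq f hy)

/-- A smooth family on the sphere extends to a smooth family off the origin. -/
lemma contDiffAt_radialProj_family {n : ℕ∞ω} {γ : ℝ → S2 → F}
    (hγ : ContMDiff (𝓘(ℝ, ℝ).prod (𝓡 2)) 𝓘(ℝ, F) n (fun p : ℝ × S2 => γ p.1 p.2))
    {p : ℝ × E3} (hp : p.2 ≠ 0) :
    ContDiffAt ℝ n (fun p : ℝ × E3 => γ p.1 (radialProj p.2)) p := by
  have h1 : ContMDiffAt (𝓘(ℝ, ℝ).prod 𝓘(ℝ, E3)) (𝓘(ℝ, ℝ).prod (𝓡 2)) n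
      (fun p : ℝ × E3 => ((p.1, radialProj p.2) : ℝ × S2)) p :=
    contMDiffAt_fst.prodMk ((contMDiffAt_radialProj hp).comp p contMDiffAt_snd)
  have h2 := (hγ (p.1, radialProj p.2)).comp p h1
  rw [← modelWithCornersSelf_prod, chartedSpaceSelf_prod] at h2
  exact h2.contDiffAt

lemma contMDiff_comp_coe_sphere {n : ℕ∞ω} {f : E3 → F} (hf : ∀ y ≠ 0, ContDiffAt ℝ n f y) :
    ContMDiff (𝓡 2) 𝓘(ℝ, F) n (fun x : S2 => f x) := fun x =>
  (hf x (ne_zero_of_mem_unit_sphere x)).contMDiffAt.comp x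
    (contMDiff_coe_sphere (E := E3) (n := 2) x)

/-- The derivative of a radial extension is homogeneous of degree `-1`. -/
lemma fderiv_radialExt (f : S2 → F) {y : E3} (hy : y ≠ 0) :
    fderiv ℝ (radialExt f) y = ‖y‖⁻¹ • fderiv ℝ (radialExt f) (radialProj y : E3) := by
  have hr : 0 < ‖y‖⁻¹ := inv_pos.2 (norm_pos_iff.2 hy)
  have h1 : radialExt f =ᶠ[nhds y] fun z => radialExt f (‖y‖⁻¹ • z) := by
    filter_upwards [isOpen_ne.mem_nhds hy] with z hz
    rw [radialExt_eq f hz, radialExt_eq f (smul_ne_zero hr.ne' hz), radialProj_smul hr z hz]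
  rw [h1.fderiv_eq, fderiv_comp_smul, coe_radialProj hy]

/-- Radial extensions have no radial derivative. -/
lemma fderiv_radialExt_self {f : S2 → F} (hf : ContMDiff (𝓡 2) 𝓘(ℝ, F) 1 f) (x : S2) :
    fderiv ℝ (radialExt f) (x : E3) (x : E3) = 0 := by
  have hx : (x : E3) ≠ 0 := ne_zero_of_mem_unit_sphere x
  have hd : DifferentiableAt ℝ (radialExt f) (x : E3) :=
    (contDiffAt_radialExt hf hx).differentiableAt one_ne_zero
  have h1 : HasDerivAt (fun t : ℝ => radialExt f ((1 + t) • (x : E3)))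
      (fderiv ℝ (radialExt f) (x : E3) (x : E3)) 0 := by
    have h2 : HasDerivAt (fun t : ℝ => (1 + t) • (x : E3)) (x : E3) 0 := by
      simpa using ((hasDerivAt_id (0 : ℝ)).const_add 1).smul_const (x : E3)
    have h3 : HasFDerivAt (radialExt f) (fderiv ℝ (radialExt f) (x : E3))
        ((1 + (0 : ℝ)) • (x : E3)) := by simpa using hd.hasFDerivAt
    exact h3.comp_hasDerivAt (0 : ℝ) h2
  have h4 : (fun t : ℝ => radialExt f ((1 + t) • (x : E3))) =ᶠ[nhds 0] fun _ => f x := by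
    filter_upwards [lt_mem_nhds (show (-1 : ℝ) < 0 by norm_num)] with t ht
    have ht' : 0 < 1 + t := by linarith
    rw [radialExt_eq f (smul_ne_zero ht'.ne' hx), radialProj_smul ht' _ hx, radialProj_coe]
  exact h1.unique ((hasDerivAt_const (0 : ℝ) (f x)).congr_of_eventuallyEq h4)

end

lemma inner_sphGrad (f : S2 → ℝ) (x : S2) (v : E3) :
    ⟪sphGrad f x, v⟫ = fderiv ℝ (radialExt f) (x : E3) v := by
  simp [sphGrad, gradient]

lemma inner_sphGrad_self {f : S2 → ℝ} (hf : ContMDiff (𝓡 2) 𝓘(ℝ, ℝ) 1 f) (x : S2) :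
    ⟪sphGrad f x, (x : E3)⟫ = 0 := by
  rw [inner_sphGrad, fderiv_radialExt_self hf]

lemma contDiffAt_gradient_radialExt {n m : ℕ∞ω} (hnm : m + 1 ≤ n) {f : S2 → ℝ}
    (hf : ContMDiff (𝓡 2) 𝓘(ℝ, ℝ) n f) {y : E3} (hy : y ≠ 0) :
    ContDiffAt ℝ m (gradient (radialExt f)) y :=
  (InnerProductSpace.toDual ℝ E3).symm.contDiff.contDiffAt.comp y
    ((contDiffAt_radialExt hf hy).fderiv_right hnm)

lemma contMDiff_sphGrad {n m : ℕ∞ω} (hnm : m + 1 ≤ n) {f : S2 → ℝ}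
    (hf : ContMDiff (𝓡 2) 𝓘(ℝ, ℝ) n f) : ContMDiff (𝓡 2) 𝓘(ℝ, E3) m (sphGrad f) :=
  contMDiff_comp_coe_sphere fun _ hy => contDiffAt_gradient_radialExt hnm hf hy

lemma continuous_sphGrad {f : S2 → ℝ} (hf : ContMDiff (𝓡 2) 𝓘(ℝ, ℝ) 1 f) :
    Continuous (sphGrad f) :=
  (contMDiff_sphGrad (m := 0) (by simp) hf).continuous

/-! ### The divergence theorem on the sphere -/

/-- Integration in polar coordinates of a product of a radial and an angular factor. -/
lemma integral_radial_mul_angular (b : ℝ → ℝ) (a : S2 → ℝ) :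
    ∫ y : E3, b ‖y‖ * a (radialProj y) =
      (∫ x, a x ∂(volume : Measure E3).toSphere) * ∫ r in Ioi (0 : ℝ), r ^ 2 * b r := by
  have h3 : Module.finrank ℝ E3 - 1 = 2 := by simp
  calc ∫ y : E3, b ‖y‖ * a (radialProj y)
      = ∫ y : ({(0 : E3)}ᶜ : Set E3), b ‖(y : E3)‖ * a (radialProj y)
          ∂((volume : Measure E3).comap (↑)) := by
        rw [integral_subtype_comap (measurableSet_singleton _).compl
          fun y : E3 => b ‖y‖ * a (radialProj y), restrict_compl_singleton]
    _ = ∫ p : S2 × Ioi (0 : ℝ), a p.1 * b p.2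
          ∂(volume : Measure E3).toSphere.prod (.volumeIoiPow 2) := by
        have := (volume : Measure E3).measurePreserving_homeomorphUnitSphereProd.integral_comp
          (Homeomorph.measurableEmbedding _) (fun p : S2 × Ioi (0 : ℝ) => a p.1 * b p.2)
        rw [h3] at this
        rw [← this]
        congr 1
        ext1 y
        have hy : (y : E3) ≠ 0 := y.2
        rw [mul_comm, homeomorphUnitSphereProd_apply_snd_coe]
        congr 2
        ext1
        rw [coe_radialProj hy, homeomorphUnitSphereProd_apply_fst_coe]
    _ = (∫ x, a x ∂(volume : Measure E3).toSphere) *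
          ∫ r : Ioi (0 : ℝ), b r ∂.volumeIoiPow 2 :=
        integral_prod_mul a fun r : Ioi (0 : ℝ) => b r
    _ = _ := by
        simp only [Measure.volumeIoiPow, ENNReal.ofReal]
        rw [integral_withDensity_eq_integral_smul,
          integral_subtype_comap measurableSet_Ioi fun r => Real.toNNReal (r ^ 2) • b r,
          setIntegral_congr_fun measurableSet_Ioi fun x hx => ?_]
        · simp only [NNReal.smul_def, Real.coe_toNNReal _ (sq_nonneg x), smul_eq_mul]
        · exact (measurable_subtype_coe.pow_const _).real_toNNReal

/-- A continuous cutoff supported in a compact set away from the origin makes functions that are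
continuous off the origin integrable. -/
lemma integrable_cutoff_mul {χ h : E3 → ℝ} (hχ : Continuous χ) (hc : HasCompactSupport χ)
    (h0 : (0 : E3) ∉ tsupport χ) (hh : ∀ y ≠ 0, ContinuousAt h y) :
    Integrable (fun y => χ y * h y) := by
  have hcont : Continuous (fun y => χ y * h y) := by
    refine continuous_of_tsupport fun y hy => ?_
    have hy' : y ∈ tsupport χ := tsupport_mul_subset_left hy
    exact hχ.continuousAt.mul (hh y fun h => h0 (h ▸ hy'))
  exact hcont.integrable_of_hasCompactSupport hc.mul_right

/-- The basic integration by parts formula on the sphere. It follows from integration by parts in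
`ℝ³` of the radial extension against a radial cutoff, in polar coordinates. -/
lemma integral_inner_sphGrad_toSphere {g : S2 → ℝ} (hg : ContMDiff (𝓡 2) 𝓘(ℝ, ℝ) 1 g) (v : E3) :
    ∫ x, ⟪sphGrad g x, v⟫ ∂(volume : Measure E3).toSphere =
      2 * ∫ x, g x * ⟪(x : E3), v⟫ ∂(volume : Measure E3).toSphere := by
  obtain ⟨ψ, hψ, hsupp, hψ0, hψpos⟩ : ∃ ψ : ℝ → ℝ, ContDiff ℝ 1 ψ ∧ tsupport ψ = Icc 1 3 ∧
      (∀ s, 0 ≤ ψ s) ∧ ∀ s ∈ Ioo (1 : ℝ) 3, 0 < ψ s := by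
    let ψ : ContDiffBump (2 : ℝ) := ⟨1 / 2, 1, by norm_num, by norm_num⟩
    refine ⟨ψ, ψ.contDiff, ?_, fun s => ψ.nonneg, fun s hs => ψ.pos_of_mem_ball ?_⟩
    · rw [ψ.tsupport_eq, Real.closedBall_eq_Icc]
      norm_num [ψ]
    · rw [Real.ball_eq_Ioo]
      norm_num [ψ]
      exact hs
  -- The cutoff is `χ(y) = ψ(‖y‖²)`, supported in `1 ≤ ‖y‖² ≤ 3`.
  let χ : E3 → ℝ := fun y => ψ (‖y‖ ^ 2)
  have hχ : ContDiff ℝ 1 χ := hψ.comp (contDiff_norm_sq ℝ)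
  have hχsupp : tsupport χ ⊆ {y : E3 | ‖y‖ ^ 2 ∈ Icc (1 : ℝ) 3} := by
    rw [← hsupp]
    exact tsupport_comp_subset_preimage ψ (f := fun y : E3 => ‖y‖ ^ 2) (by fun_prop)
  have h0 : (0 : E3) ∉ tsupport χ := fun h => by
    have := (hχsupp h).1
    norm_num at this
  have hχc : HasCompactSupport χ := by
    refine HasCompactSupport.of_support_subset_isCompact (isCompact_closedBall (0 : E3) 2) ?_
    intro y hy
    have := (hχsupp (subset_tsupport _ hy)).2
    rw [mem_closedBall_zero_iff]
    nlinarith [norm_nonneg y]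
  have hdχ (y : E3) : fderiv ℝ χ y v = deriv ψ (‖y‖ ^ 2) * (2 * ⟪y, v⟫) := by
    have h1 : HasDerivAt ψ (deriv ψ (‖y‖ ^ 2)) (‖y‖ ^ 2) :=
      ((hψ.differentiable one_ne_zero) _).hasDerivAt
    have h2 : HasFDerivAt χ _ y :=
      h1.comp_hasFDerivAt y (hasStrictFDerivAt_norm_sq y).hasFDerivAt
    rw [h2.fderiv]
    simp
  have hdχ0 : (0 : E3) ∉ tsupport (fun y => fderiv ℝ χ y v) := fun h =>
    h0 (tsupport_fderiv_apply_subset ℝ v h)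
  have hdχc : HasCompactSupport (fun y => fderiv ℝ χ y v) := hχc.fderiv_apply ℝ v
  have hgat {y : E3} (hy : y ≠ 0) : ContDiffAt ℝ 1 (radialExt g) y := contDiffAt_radialExt hg hy
  have hdcont : Continuous fun y => fderiv ℝ χ y v :=
    (hχ.continuous_fderiv one_ne_zero).clm_apply continuous_const
  have hparts := integral_mul_fderiv_eq_neg_fderiv_mul_of_integrable (μ := (volume : Measure E3))
    (f := χ) (g := radialExt g) (v := v)
    (integrable_cutoff_mul hdcont hdχc hdχ0 fun y hy => (hgat hy).continuousAt)
    (integrable_cutoff_mul hχ.continuous hχc h0 fun y hy =>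
      ((hgat hy).continuousAt_fderiv one_ne_zero).clm_apply continuousAt_const)
    (integrable_cutoff_mul hχ.continuous hχc h0 fun y hy => (hgat hy).continuousAt)
    (fun y _ => hχ.differentiable one_ne_zero y)
    (fun y hy => (hgat fun h => h0 (h ▸ hy)).differentiableAt one_ne_zero)
  have hae : ∀ᵐ y : E3, y ≠ 0 := by simp [ae_iff]
  have hL : ∫ y, χ y * fderiv ℝ (radialExt g) y v =
      ∫ y : E3, (ψ (‖y‖ ^ 2) * ‖y‖⁻¹) * ⟪sphGrad g (radialProj y), v⟫ := by
    refine integral_congr_ae (hae.mono fun y hy => ?_)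
    simp only [χ]
    rw [inner_sphGrad, fderiv_radialExt g hy]
    simp [mul_assoc]
  have hR : ∫ y, fderiv ℝ χ y v * radialExt g y =
      ∫ y : E3, (2 * deriv ψ (‖y‖ ^ 2) * ‖y‖) *
        (g (radialProj y) * ⟪(radialProj y : E3), v⟫) := by
    refine integral_congr_ae (hae.mono fun y hy => ?_)
    have hy' := norm_ne_zero_iff.2 hy
    simp only
    rw [hdχ, radialExt_eq g hy, coe_radialProj hy, real_inner_smul_left]
    field_simp
  rw [hL, hR, integral_radial_mul_angular (fun r => ψ (r ^ 2) * r⁻¹) (fun x => ⟪sphGrad g x, v⟫),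
    integral_radial_mul_angular (fun r => 2 * deriv ψ (r ^ 2) * r) (fun x => g x * ⟪(x : E3), v⟫)]
    at hparts
  -- The two radial integrals are `A` and `-2 A`, because the derivative of `r ↦ r² ψ(r²)` has
  -- integral zero.
  have hder (r : ℝ) : HasDerivAt (fun r : ℝ => r ^ 2 * ψ (r ^ 2))
      (2 * r * ψ (r ^ 2) + r ^ 2 * (deriv ψ (r ^ 2) * (2 * r))) r := by
    have h1 : HasDerivAt ψ (deriv ψ (r ^ 2)) (r ^ 2) :=
      ((hψ.differentiable one_ne_zero) _).hasDerivAt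
    have h2 : HasDerivAt (fun r : ℝ => r ^ 2) (2 * r) r := by simpa using hasDerivAt_pow 2 r
    exact h2.mul (HasDerivAt.comp (h := fun r : ℝ => r ^ 2) r h1 h2)
  have hψ2c : HasCompactSupport fun r : ℝ => ψ (r ^ 2) := by
    refine HasCompactSupport.of_support_subset_isCompact (isCompact_Icc (a := (-2 : ℝ)) (b := 2)) ?_
    intro r hr
    have h1 : r ^ 2 ∈ tsupport ψ := subset_tsupport _ hr
    rw [hsupp] at h1
    constructor <;> nlinarith [h1.2]
  have hψ'c : HasCompactSupport fun r : ℝ => deriv ψ (r ^ 2) := by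
    refine HasCompactSupport.of_support_subset_isCompact (isCompact_Icc (a := (-2 : ℝ)) (b := 2)) ?_
    intro r hr
    have h1 : r ^ 2 ∈ tsupport ψ := tsupport_deriv_subset (subset_tsupport _ hr)
    rw [hsupp] at h1
    constructor <;> nlinarith [h1.2]
  have hcψ : Continuous fun r : ℝ => ψ (r ^ 2) := hψ.continuous.comp (by fun_prop)
  have hcψ' : Continuous fun r : ℝ => deriv ψ (r ^ 2) :=
    (hψ.continuous_deriv le_rfl).comp (by fun_prop)
  have hi1 : Integrable fun r : ℝ => r * ψ (r ^ 2) :=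
    (continuous_id.mul hcψ).integrable_of_hasCompactSupport hψ2c.mul_left
  have hi2 : Integrable fun r : ℝ => r ^ 2 * (2 * deriv ψ (r ^ 2) * r) := by
    refine Continuous.integrable_of_hasCompactSupport (by fun_prop) ?_
    exact ((hψ'c.mul_left (f := fun _ => (2 : ℝ))).mul_right (f' := fun r : ℝ => r)).mul_left
  have hA : ∫ r in Ioi (0 : ℝ), r ^ 2 * (ψ (r ^ 2) * r⁻¹) = ∫ r in Ioi (0 : ℝ), r * ψ (r ^ 2) := by
    refine setIntegral_congr_fun measurableSet_Ioi fun r hr => ?_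
    have : r ≠ 0 := (mem_Ioi.1 hr).ne'
    field_simp
  have hB : ∫ r in Ioi (0 : ℝ), r ^ 2 * (2 * deriv ψ (r ^ 2) * r) =
      -(2 * ∫ r in Ioi (0 : ℝ), r * ψ (r ^ 2)) := by
    have h1 : ∫ r in Ioi (0 : ℝ), deriv (fun r : ℝ => r ^ 2 * ψ (r ^ 2)) r = 0 := by
      have hcd : ContDiff ℝ 1 fun r : ℝ => r ^ 2 * ψ (r ^ 2) :=
        (contDiff_id.pow 2).mul (hψ.comp (contDiff_id.pow 2))
      rw [HasCompactSupport.integral_Ioi_deriv_eq hcd hψ2c.mul_left]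
      simp
    have h2 : (fun r : ℝ => deriv (fun r : ℝ => r ^ 2 * ψ (r ^ 2)) r) =
        fun r => 2 * (r * ψ (r ^ 2)) + r ^ 2 * (2 * deriv ψ (r ^ 2) * r) := by
      ext1 r
      rw [(hder r).deriv]
      ring
    rw [h2, integral_add (hi1.const_mul 2).integrableOn hi2.integrableOn,
      integral_const_mul] at h1
    linarith
  have hpos : 0 < ∫ r in Ioi (0 : ℝ), r * ψ (r ^ 2) := by
    rw [setIntegral_pos_iff_support_of_nonneg_ae
      ((ae_restrict_mem measurableSet_Ioi).mono fun r hr => mul_nonneg (le_of_lt hr) (hψ0 _))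
      hi1.integrableOn]
    have hsub : Ioo (5 / 4 : ℝ) (3 / 2) ⊆
        (Function.support fun r : ℝ => r * ψ (r ^ 2)) ∩ Ioi 0 := by
      intro r hr
      have hr0 : 0 < r := by linarith [hr.1]
      refine ⟨mul_ne_zero hr0.ne' (hψpos _ ?_).ne', hr0⟩
      constructor <;> nlinarith [hr.1, hr.2]
    refine lt_of_lt_of_le ?_ (measure_mono hsub)
    simp
    norm_num
  rw [hA, hB] at hparts
  have := mul_right_cancel₀ hpos.ne' (hparts.trans (b := _) (c :=
    (2 * ∫ x, g x * ⟪(x : E3), v⟫ ∂(volume : Measure E3).toSphere) *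
      ∫ r in Ioi (0 : ℝ), r * ψ (r ^ 2)) (by ring))
  exact this

lemma integral_inner_sphGrad {g : S2 → ℝ} (hg : ContMDiff (𝓡 2) 𝓘(ℝ, ℝ) 1 g) (v : E3) :
    ∫ x, ⟪sphGrad g x, v⟫ ∂omega = 2 * ∫ x, g x * ⟪(x : E3), v⟫ ∂omega := by
  simp only [omega, integral_smul_measure, integral_inner_sphGrad_toSphere hg v, smul_eq_mul]
  ring

lemma Continuous.integrable_omega {F : Type*} [NormedAddCommGroup F] {f : S2 → F}
    (hf : Continuous f) : Integrable f omega := by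
  rw [← integrableOn_univ]
  exact hf.continuousOn.integrableOn_compact isCompact_univ

lemma Continuous.memLp_omega {F : Type*} [NormedAddCommGroup F] {f : S2 → F}
    (hf : Continuous f) (p : ENNReal) : MemLp f p omega := by
  obtain ⟨C, hC⟩ := isCompact_univ.exists_bound_of_continuousOn hf.continuousOn
  exact MemLp.of_bound hf.aestronglyMeasurable C (.of_forall fun x => hC x (mem_univ x))

lemma sphDiv_eq_sum (X : S2 → E3) (x : S2) (b : OrthonormalBasis (Fin 3) ℝ E3) :
    sphDiv X x = ∑ i, ⟪b i, fderiv ℝ (radialExt X) (x : E3) (b i)⟫ := by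
  rw [sphDiv, LinearMap.trace_eq_sum_inner _ b]
  rfl

lemma continuous_sphDiv {X : S2 → E3} (hX : ContMDiff (𝓡 2) 𝓘(ℝ, E3) 1 X) :
    Continuous (sphDiv X) := by
  have h1 : Continuous fun x : S2 => fderiv ℝ (radialExt X) (x : E3) := by
    rw [continuous_iff_continuousAt]
    intro x
    exact ((contDiffAt_radialExt hX (ne_zero_of_mem_unit_sphere x)).continuousAt_fderiv
      one_ne_zero).comp continuous_subtype_val.continuousAt
  rw [funext fun x => sphDiv_eq_sum X x (EuclideanSpace.basisFun (Fin 3) ℝ)]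
  exact continuous_finsetSum _ fun i _ => continuous_const.inner (h1.clm_apply continuous_const)

/-- The divergence theorem on `𝕊²`, for continuously differentiable functions and fields. -/
lemma integral_inner_sphGrad_field {u : S2 → ℝ} (hu : ContMDiff (𝓡 2) 𝓘(ℝ, ℝ) 1 u) {X : S2 → E3}
    (hX : ContMDiff (𝓡 2) 𝓘(ℝ, E3) 1 X) (hXt : ∀ x, ⟪X x, (x : E3)⟫ = 0) :
    ∫ x, ⟪sphGrad u x, X x⟫ ∂omega = -∫ x, u x * sphDiv X x ∂omega := by
  let b := EuclideanSpace.basisFun (Fin 3) ℝ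
  have hXi (i : Fin 3) : ContMDiff (𝓡 2) 𝓘(ℝ, ℝ) 1 fun x => ⟪b i, X x⟫ := fun x =>
    ((innerSL ℝ (b i)).contDiff.contMDiff (X x)).comp x (hX x)
  have huXi (i : Fin 3) : ContMDiff (𝓡 2) 𝓘(ℝ, ℝ) 1 fun x => u x * ⟪b i, X x⟫ :=
    hu.mul (hXi i)
  have hprod (i : Fin 3) (x : S2) : ⟪sphGrad (fun x => u x * ⟪b i, X x⟫) x, b i⟫ =
      ⟪sphGrad u x, b i⟫ * ⟪b i, X x⟫ + u x * ⟪b i, fderiv ℝ (radialExt X) (x : E3) (b i)⟫ := by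
    have hx : (x : E3) ≠ 0 := ne_zero_of_mem_unit_sphere x
    have h1 : radialExt (fun x => u x * ⟪b i, X x⟫) =
        fun y => radialExt u y * ⟪b i, radialExt X y⟫ := by
      ext1 y
      by_cases hy : y = 0
      · simp [radialExt, hy]
      · simp only [radialExt_eq _ hy]
    have hdu : HasFDerivAt (radialExt u) _ (x : E3) :=
      ((contDiffAt_radialExt hu hx).differentiableAt one_ne_zero).hasFDerivAt
    have hdX : HasFDerivAt (radialExt X) _ (x : E3) :=
      ((contDiffAt_radialExt hX hx).differentiableAt one_ne_zero).hasFDerivAt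
    have h2 := hdu.mul ((innerSL ℝ (b i)).hasFDerivAt.comp (x : E3) hdX)
    have h3 : fderiv ℝ (fun y => radialExt u y * ⟪b i, radialExt X y⟫) (x : E3) = _ := h2.fderiv
    rw [inner_sphGrad, inner_sphGrad, h1, h3]
    simp
    ring
  -- The integrand `⟨∇u, X⟩ + u div X` is the sum of the components of the gradients of `u X_i`; the
  -- basic formula turns its integral into that of `2 u ⟨X, x⟩ = 0`.
  have hsum (x : S2) : ⟪sphGrad u x, X x⟫ + u x * sphDiv X x =
      ∑ i, ⟪sphGrad (fun x => u x * ⟪b i, X x⟫) x, b i⟫ := by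
    simp_rw [hprod, Finset.sum_add_distrib, ← Finset.mul_sum, b.sum_inner_mul_inner,
      sphDiv_eq_sum X x b]
  have hsum2 (x : S2) : ∑ i, u x * ⟪b i, X x⟫ * ⟪(x : E3), b i⟫ = 0 := by
    simp_rw [mul_assoc, ← Finset.mul_sum, mul_comm ⟪b _, X x⟫]
    rw [b.sum_inner_mul_inner, real_inner_comm, hXt, mul_zero]
  have hi1 : Integrable (fun x => ⟪sphGrad u x, X x⟫) omega :=
    ((continuous_sphGrad hu).inner hX.continuous).integrable_omega
  have hi2 : Integrable (fun x => u x * sphDiv X x) omega :=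
    (hu.continuous.mul (continuous_sphDiv hX)).integrable_omega
  rw [eq_neg_iff_add_eq_zero, ← integral_add hi1 hi2]
  simp_rw [hsum]
  rw [integral_finsetSum _ fun i _ =>
    ((continuous_sphGrad (huXi i)).inner continuous_const).integrable_omega]
  simp_rw [fun i => integral_inner_sphGrad (huXi i) (b i)]
  have hi3 (i : Fin 3) : Integrable (fun x : S2 => u x * ⟪b i, X x⟫ * ⟪(x : E3), b i⟫) omega :=
    ((huXi i).continuous.mul
      (continuous_subtype_val.inner continuous_const)).integrable_omega
  rw [← Finset.mul_sum, ← integral_finsetSum _ fun i _ => hi3 i]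
  simp [hsum2]

/-- The Laplace–Beltrami operator is the divergence of the gradient. -/
lemma sphDiv_sphGrad {u : S2 → ℝ} (hu : ContMDiff (𝓡 2) 𝓘(ℝ, ℝ) 2 u) (x : S2) :
    sphDiv (sphGrad u) x = sphLaplacian u x := by
  have hu1 : ContMDiff (𝓡 2) 𝓘(ℝ, ℝ) 1 u := hu.of_le one_le_two
  let b := EuclideanSpace.basisFun (Fin 3) ℝ
  have hx : (x : E3) ≠ 0 := ne_zero_of_mem_unit_sphere x
  have hnx : ‖(x : E3)‖ = 1 := norm_eq_of_mem_sphere x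
  have hdf : DifferentiableAt ℝ (fderiv ℝ (radialExt u)) (x : E3) :=
    ((contDiffAt_radialExt hu hx).fderiv_right (m := 1) (by norm_num)).differentiableAt one_ne_zero
  -- Off the origin the radial extension of `∇u` is `‖y‖` times the Euclidean gradient.
  have h1 : radialExt (sphGrad u) =ᶠ[nhds (x : E3)]
      fun y => ‖y‖ • gradient (radialExt u) y := by
    filter_upwards [isOpen_ne.mem_nhds hx] with y hy
    rw [radialExt_eq _ hy, sphGrad, gradient, gradient, fderiv_radialExt u hy, map_smul, smul_smul,
      mul_inv_cancel₀ (norm_ne_zero_iff.2 hy), one_smul]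
  let T := (InnerProductSpace.toDual ℝ E3).symm.toContinuousLinearEquiv.toContinuousLinearMap
  have h2 : HasFDerivAt (fun y => ‖y‖ • gradient (radialExt u) y) _ (x : E3) :=
    (differentiableAt_id.norm ℝ hx).hasFDerivAt.smul
      (T.hasFDerivAt.comp (x : E3) hdf.hasFDerivAt)
  have h3 (i : Fin 3) : ⟪b i, fderiv ℝ (radialExt (sphGrad u)) (x : E3) (b i)⟫ =
      fderiv ℝ (fun y : E3 => ‖y‖) (x : E3) (b i) * ⟪sphGrad u x, b i⟫ +
        fderiv ℝ (fderiv ℝ (radialExt u)) (x : E3) (b i) (b i) := by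
    rw [h1.fderiv_eq, h2.fderiv]
    simp only [add_apply, smul_apply, id,
      ContinuousLinearMap.comp_apply, ContinuousLinearMap.smulRight_apply, inner_add_right,
      inner_smul_right, hnx, one_mul]
    rw [add_comm, real_inner_comm (b i)]
    congr 1
    rw [real_inner_comm]
    exact InnerProductSpace.toDual_symm_apply
  have h4 (v : E3) : fderiv ℝ (fun y : E3 => ‖y‖) (x : E3) v = ⟪(x : E3), v⟫ := by
    have h5 : HasFDerivAt (fun y : E3 => ‖y‖ ^ 2) _ (x : E3) :=
      (differentiableAt_id.norm ℝ hx).hasFDerivAt.pow 2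
    have h6 := congrArg (fun L => L v)
      (h5.unique (hasStrictFDerivAt_norm_sq (x : E3)).hasFDerivAt)
    simpa [hnx] using h6
  -- The terms from differentiating `‖y‖` add up to `⟨x, ∇u⟩ = 0`.
  rw [sphDiv_eq_sum _ _ b, sphLaplacian,
    InnerProductSpace.laplacian_eq_iteratedFDeriv_orthonormalBasis _ b]
  simp_rw [h3, h4, Finset.sum_add_distrib, real_inner_comm (b _) (sphGrad u x)]
  rw [b.sum_inner_mul_inner, real_inner_comm, inner_sphGrad_self hu1, zero_add]
  simp [iteratedFDeriv_two_apply]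

lemma integral_inner_sphGrad_sphGrad {u φ : S2 → ℝ} (hu : ContMDiff (𝓡 2) 𝓘(ℝ, ℝ) 2 u)
    (hφ : ContMDiff (𝓡 2) 𝓘(ℝ, ℝ) 1 φ) :
    ∫ x, ⟪sphGrad u x, sphGrad φ x⟫ ∂omega = -∫ x, sphLaplacian u x * φ x ∂omega := by
  have hu1 : ContMDiff (𝓡 2) 𝓘(ℝ, ℝ) 1 u := hu.of_le one_le_two
  have h := integral_inner_sphGrad_field hφ (contMDiff_sphGrad (m := 1) (by norm_num) hu)
    (inner_sphGrad_self hu1)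
  simp_rw [sphDiv_sphGrad hu] at h
  simp_rw [real_inner_comm (sphGrad φ _), mul_comm (sphLaplacian u _)]
  exact h

lemma continuous_sphLaplacian {u : S2 → ℝ} (hu : ContMDiff (𝓡 2) 𝓘(ℝ, ℝ) 2 u) :
    Continuous (sphLaplacian u) := by
  rw [← funext (sphDiv_sphGrad hu)]
  exact continuous_sphDiv (contMDiff_sphGrad (m := 1) (by norm_num) hu)

/-! ### Weak gradients -/

/-- For continuously differentiable functions the gradient is a weak gradient. -/
lemma isWeakGrad_sphGrad {u : S2 → ℝ} (hu : ContMDiff (𝓡 2) 𝓘(ℝ, ℝ) 1 u) :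
    IsWeakGrad u (sphGrad u) where
  memLp := (continuous_sphGrad hu).memLp_omega 2
  tangent := .of_forall (inner_sphGrad_self hu)
  integral_eq X hX := integral_inner_sphGrad_field hu (hX.1.of_le (by norm_cast)) hX.2

lemma MeasureTheory.MemLp.integrable_inner_continuous {G X : S2 → E3} (hG : MemLp G 2 omega)
    (hX : Continuous X) : Integrable (fun x => ⟪G x, X x⟫) omega := by
  obtain ⟨C, hC⟩ := isCompact_univ.exists_bound_of_continuousOn hX.continuousOn
  refine ((hG.integrable one_le_two).norm.mul_const C).mono
    (hG.1.inner hX.aestronglyMeasurable) (.of_forall fun x => ?_)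
  refine (norm_inner_le_norm _ _).trans ((mul_le_mul_of_nonneg_left (hC x (mem_univ x))
    (norm_nonneg _)).trans (le_of_eq ?_))
  have hC0 : 0 ≤ C := (norm_nonneg _).trans (hC x (mem_univ x))
  rw [Real.norm_of_nonneg (by positivity)]

/-- The tangential projection of a constant field, multiplied by a smooth function. -/
lemma isSmoothTangentField_proj {g : S2 → ℝ} (hg : IsSmooth g) (v : E3) :
    IsSmoothTangentField fun x => g x • (v - ⟪v, (x : E3)⟫ • (x : E3)) := by
  constructor
  · have h1 : ContMDiff (𝓡 2) 𝓘(ℝ, E3) ∞ (fun x : S2 => v - ⟪v, (x : E3)⟫ • (x : E3)) := by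
      refine contMDiff_comp_coe_sphere (f := fun y => v - ⟪v, y⟫ • y) fun y _ => ?_
      exact contDiffAt_const.sub ((contDiffAt_const.inner ℝ contDiffAt_id).smul contDiffAt_id)
    have hg' : ContMDiff (𝓡 2) 𝓘(ℝ, ℝ) ∞ g := hg
    exact hg'.smul h1
  · intro x
    simp [inner_smul_left, inner_sub_left]

/-- Weak gradients are unique, since every smooth field can be projected to a tangent field. -/
lemma IsWeakGrad.ae_eq {u : S2 → ℝ} {G G' : S2 → E3} (h : IsWeakGrad u G) (h' : IsWeakGrad u G') :
    G =ᵐ[omega] G' := by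
  have hD : MemLp (fun x => G x - G' x) 2 omega := h.memLp.sub h'.memLp
  have key : ∀ᵐ x ∂omega, G x - G' x = 0 := by
    refine ae_eq_zero_of_integral_contMDiff_smul_eq_zero (𝓡 2)
      (hD.integrable one_le_two).locallyIntegrable fun g hg hgc => ?_
    have hgD : Integrable (fun x => g x • (G x - G' x)) omega :=
      (hD.integrable one_le_two).locallyIntegrable.integrable_smul_left_of_hasCompactSupport
        hg.continuous hgc
    refine ext_inner_left ℝ fun v => ?_
    rw [← integral_inner hgD, inner_zero_right]
    let X : S2 → E3 := fun x => g x • (v - ⟪v, (x : E3)⟫ • (x : E3))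
    have hX : IsSmoothTangentField X := isSmoothTangentField_proj hg v
    have hXc : Continuous X := hX.1.continuous
    calc ∫ x, ⟪v, g x • (G x - G' x)⟫ ∂omega
        = ∫ x, (⟪G x, X x⟫ - ⟪G' x, X x⟫) ∂omega := by
          refine integral_congr_ae ?_
          filter_upwards [h.tangent, h'.tangent] with x h1 h2
          simp only [X, inner_smul_right, inner_sub_right, h1, h2, real_inner_comm v]
          ring
      _ = 0 := by
          rw [integral_sub (h.memLp.integrable_inner_continuous hXc)
            (h'.memLp.integrable_inner_continuous hXc), h.integral_eq X hX, h'.integral_eq X hX,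
            sub_self]
  filter_upwards [key] with x hx using sub_eq_zero.1 hx

lemma isWeakGrad_weakGrad {u : S2 → ℝ} (h : ∃ G, IsWeakGrad u G) : IsWeakGrad u (weakGrad u) := by
  rw [weakGrad, dif_pos h]
  exact h.choose_spec

lemma IsWeakGrad.add {u v : S2 → ℝ} {G H : S2 → E3} (hG : IsWeakGrad u G) (hH : IsWeakGrad v H)
    (hu : MemLp u 2 omega) (hv : MemLp v 2 omega) :
    IsWeakGrad (fun x => u x + v x) (fun x => G x + H x) where
  memLp := hG.memLp.add hH.memLp
  tangent := by
    filter_upwards [hG.tangent, hH.tangent] with x h1 h2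
    rw [inner_add_left, h1, h2, add_zero]
  integral_eq X hX := by
    have hXc : Continuous X := hX.1.continuous
    have hdiv := continuous_sphDiv (hX.1.of_le (by norm_cast))
    have hi {w : S2 → ℝ} (hw : MemLp w 2 omega) :
        Integrable (fun x => w x * sphDiv X x) omega :=
      hw.integrable_mul (hdiv.memLp_omega 2)
    simp_rw [inner_add_left, add_mul]
    rw [integral_add (hG.memLp.integrable_inner_continuous hXc)
      (hH.memLp.integrable_inner_continuous hXc), integral_add (hi hu) (hi hv),
      hG.integral_eq X hX, hH.integral_eq X hX, neg_add]

lemma MemH1.isWeakGrad_add {u γ : S2 → ℝ} (hu : MemH1 u) (hγ : ContMDiff (𝓡 2) 𝓘(ℝ, ℝ) 1 γ) :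
    IsWeakGrad (fun x => u x + γ x) (fun x => weakGrad u x + sphGrad γ x) :=
  (isWeakGrad_weakGrad hu.2).add (isWeakGrad_sphGrad hγ) hu.1 (hγ.continuous.memLp_omega 2)

lemma MemH1.add {u γ : S2 → ℝ} (hu : MemH1 u) (hγ : ContMDiff (𝓡 2) 𝓘(ℝ, ℝ) 1 γ) :
    MemH1 (fun x => u x + γ x) :=
  ⟨MemLp.add hu.1 (hγ.continuous.memLp_omega 2), _, hu.isWeakGrad_add hγ⟩

lemma MemH1.weakGrad_add {u γ : S2 → ℝ} (hu : MemH1 u) (hγ : ContMDiff (𝓡 2) 𝓘(ℝ, ℝ) 1 γ) :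
    weakGrad (fun x => u x + γ x) =ᵐ[omega] fun x => weakGrad u x + sphGrad γ x :=
  (isWeakGrad_weakGrad ⟨_, hu.isWeakGrad_add hγ⟩).ae_eq (hu.isWeakGrad_add hγ)

/-! ### The moments of the conformal measure -/

instance : omega.IsOpenPosMeasure :=
  Measure.isOpenPosMeasure_smul _ (ENNReal.inv_ne_zero.2 (measure_ne_top _ _))

lemma integrable_exp_of_mem_classH {u : S2 → ℝ} (hu : u ∈ classH) :
    Integrable (fun x => Real.exp (2 * u x)) omega := by
  by_contra h
  have h1 := hu.2
  rw [integral_undef h] at h1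
  exact zero_ne_one h1

lemma MeasureTheory.Integrable.mul_continuous {w f : S2 → ℝ} (hw : Integrable w omega)
    (hf : Continuous f) : Integrable (fun x => w x * f x) omega := by
  obtain ⟨C, hC⟩ := isCompact_univ.exists_bound_of_continuousOn hf.continuousOn
  exact hw.mul_bdd hf.aestronglyMeasurable (.of_forall fun x => hC x (mem_univ x))

lemma continuous_coord (i : Fin 3) : Continuous fun x : S2 => (x : E3) i := by fun_prop

/-- The center of mass of the probability measure `e^{2u} dω` lies in the open unit ball, because
the measure is not concentrated at a point. -/
lemma sum_moment_sq_lt_one {u : S2 → ℝ} (hu : u ∈ classH) : ∑ i, moment u i ^ 2 < 1 := by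
  have hint := integrable_exp_of_mem_classH hu
  let a : E3 := WithLp.toLp 2 (moment u)
  have ha2 : ‖a‖ ^ 2 = ∑ i, moment u i ^ 2 := by
    simp [a, EuclideanSpace.norm_sq_eq]
  rw [← ha2]
  by_contra! hge
  have hn : 1 ≤ ‖a‖ := by
    by_contra! h
    nlinarith [norm_nonneg a]
  have hcont : Continuous fun x : S2 => ‖a‖ - ⟪a, (x : E3)⟫ := by fun_prop
  have hnonneg (x : S2) : 0 ≤ ‖a‖ - ⟪a, (x : E3)⟫ := by
    have := real_inner_le_norm a (x : E3)
    rw [norm_eq_of_mem_sphere x] at this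
    linarith
  have hinner : ∫ x, Real.exp (2 * u x) * ⟪a, (x : E3)⟫ ∂omega = ‖a‖ ^ 2 := by
    have h1 (x : S2) : Real.exp (2 * u x) * ⟪a, (x : E3)⟫ =
        ∑ i, moment u i * (Real.exp (2 * u x) * (x : E3) i) := by
      simp only [a, PiLp.inner_apply, Finset.mul_sum]
      refine Finset.sum_congr rfl fun i _ => ?_
      simp
      ring
    simp_rw [h1]
    rw [integral_finsetSum _ fun i _ => (hint.mul_continuous (continuous_coord i)).const_mul _, ha2]
    refine Finset.sum_congr rfl fun i _ => ?_
    rw [integral_const_mul, sq]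
    rfl
  have hI : ∫ x, Real.exp (2 * u x) * (‖a‖ - ⟪a, (x : E3)⟫) ∂omega = ‖a‖ - ‖a‖ ^ 2 := by
    simp_rw [mul_sub]
    rw [integral_sub (hint.mul_const _) (hint.mul_continuous (by fun_prop)), hinner,
      integral_mul_const, hu.2, one_mul]
  have hzero : ∫ x, Real.exp (2 * u x) * (‖a‖ - ⟪a, (x : E3)⟫) ∂omega = 0 := by
    refine le_antisymm (by rw [hI]; nlinarith) ?_
    exact integral_nonneg fun x => mul_nonneg (Real.exp_pos _).le (hnonneg x)
  rw [integral_eq_zero_iff_of_nonneg (fun x => mul_nonneg (Real.exp_pos _).le (hnonneg x))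
    (hint.mul_continuous hcont)] at hzero
  have hae : (fun x : S2 => ‖a‖ - ⟪a, (x : E3)⟫) =ᵐ[omega] fun _ => 0 := by
    filter_upwards [hzero] with x hx
    exact (mul_eq_zero.1 hx).resolve_left (Real.exp_ne_zero _)
  have hall := (hcont.ae_eq_iff_eq omega continuous_const).1 hae
  -- Evaluating at two antipodal points gives `‖a‖ = 0`.
  let e : S2 := ⟨EuclideanSpace.single 0 1, by simp⟩
  have h1 := congrFun hall e
  have h2 := congrFun hall (-e)
  simp only [coe_neg_sphere, inner_neg_right] at h1 h2
  linarith

/-! ### The weak form of the equation -/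

/-- The weak form of the equation, as a linear functional of the test function. -/
noncomputable def weakForm (α : ℝ) (u φ : S2 → ℝ) : ℝ :=
  -(α * ∫ x, ⟪weakGrad u x, sphGrad φ x⟫ ∂omega) + ∫ x, eulerTerm u x * φ x ∂omega

lemma integral_eulerTerm_mul {u φ : S2 → ℝ} (hu : u ∈ classH) (hφ : Continuous φ) :
    ∫ x, eulerTerm u x * φ x ∂omega =
      (1 - ∑ i, moment u i ^ 2)⁻¹ * ((∫ x, Real.exp (2 * u x) * φ x ∂omega) -
        ∑ i, moment u i * ∫ x, Real.exp (2 * u x) * (x : E3) i * φ x ∂omega) - ∫ x, φ x ∂omega := by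
  have hint := integrable_exp_of_mem_classH hu
  have h1 (x : S2) : eulerTerm u x * φ x =
      (1 - ∑ i, moment u i ^ 2)⁻¹ * (Real.exp (2 * u x) * φ x -
        ∑ i, moment u i * (Real.exp (2 * u x) * (x : E3) i * φ x)) - φ x := by
    have h2 : ∑ i, moment u i * (Real.exp (2 * u x) * (x : E3) i * φ x) =
        (∑ i, moment u i * (x : E3) i) * (Real.exp (2 * u x) * φ x) := by
      rw [Finset.sum_mul]
      exact Finset.sum_congr rfl fun i _ => by ring
    rw [h2, eulerTerm, div_eq_mul_inv]
    ring
  have hi (i : Fin 3) : Integrable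
      (fun x : S2 => moment u i * (Real.exp (2 * u x) * (x : E3) i * φ x)) omega :=
    ((hint.mul_continuous (continuous_coord i)).mul_continuous hφ).const_mul _
  have hs := integrable_finsetSum Finset.univ fun i _ => hi i
  have hd : Integrable (fun x => Real.exp (2 * u x) * φ x -
      ∑ i, moment u i * (Real.exp (2 * u x) * (x : E3) i * φ x)) omega :=
    (hint.mul_continuous hφ).sub hs
  simp_rw [h1]
  rw [integral_sub (hd.const_mul _) hφ.integrable_omega,
    integral_const_mul, integral_sub (hint.mul_continuous hφ) hs,
    integral_finsetSum _ fun i _ => hi i]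
  simp_rw [integral_const_mul]

lemma integrable_eulerTerm_mul {u φ : S2 → ℝ} (hu : u ∈ classH) (hφ : Continuous φ) :
    Integrable (fun x => eulerTerm u x * φ x) omega := by
  have h1 := (integrable_exp_of_mem_classH hu).mul_continuous
    (f := fun x => (1 - ∑ i, moment u i * (x : E3) i) / (1 - ∑ i, moment u i ^ 2)) (by fun_prop)
  have h2 : Integrable (eulerTerm u) omega := by
    refine (h1.sub (integrable_const 1)).congr (.of_forall fun x => ?_)
    simp [eulerTerm, mul_comm]
  exact h2.mul_continuous hφ

/-! ### Differentiation of integrals over the sphere with respect to a parameter -/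

/-- Differentiation under the integral sign: the weight `w` is only integrable, the parametric
factor is continuously differentiable near the sphere. -/
lemma hasDerivAt_integral_inner {F : Type*} [NormedAddCommGroup F] [InnerProductSpace ℝ F]
    {w : S2 → F} (hw : Integrable w omega) {H : ℝ × E3 → F}
    (hH : ∀ p : ℝ × E3, p.2 ≠ 0 → ContDiffAt ℝ 1 H p) (t₀ : ℝ) :
    HasDerivAt (fun t => ∫ x, ⟪w x, H (t, (x : E3))⟫ ∂omega)
      (∫ x, ⟪w x, fderiv ℝ H (t₀, (x : E3)) (1, 0)⟫ ∂omega) t₀ := by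
  have hne (x : S2) : (x : E3) ≠ 0 := ne_zero_of_mem_unit_sphere x
  have hemb : Continuous fun p : ℝ × S2 => (p.1, (p.2 : E3)) := by fun_prop
  have hHc : Continuous fun p : ℝ × S2 => H (p.1, (p.2 : E3)) := by
    rw [continuous_iff_continuousAt]
    exact fun p => (hH (p.1, (p.2 : E3)) (hne p.2)).continuousAt.comp
      (f := fun p : ℝ × S2 => (p.1, (p.2 : E3))) hemb.continuousAt
  have hdc : Continuous fun p : ℝ × S2 => fderiv ℝ H (p.1, (p.2 : E3)) (1, 0) := by
    have h1 : Continuous fun p : ℝ × S2 => fderiv ℝ H (p.1, (p.2 : E3)) := by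
      rw [continuous_iff_continuousAt]
      exact fun p => ((hH (p.1, (p.2 : E3)) (hne p.2)).continuousAt_fderiv one_ne_zero).comp
        (f := fun p : ℝ × S2 => (p.1, (p.2 : E3))) hemb.continuousAt
    exact h1.clm_apply continuous_const
  have hslice (t : ℝ) : Continuous fun x : S2 => H (t, (x : E3)) :=
    hHc.comp (Continuous.prodMk_right t)
  have hdslice (t : ℝ) : Continuous fun x : S2 => fderiv ℝ H (t, (x : E3)) (1, 0) :=
    hdc.comp (Continuous.prodMk_right t)
  have hder (t : ℝ) (x : S2) : HasDerivAt (fun t => H (t, (x : E3)))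
      (fderiv ℝ H (t, (x : E3)) (1, 0)) t := by
    have h1 : HasFDerivAt H _ (t, (x : E3)) :=
      ((hH (t, (x : E3)) (hne x)).differentiableAt one_ne_zero).hasFDerivAt
    exact h1.comp_hasDerivAt (f := fun t => (t, (x : E3))) t
      ((hasDerivAt_id t).prodMk (hasDerivAt_const t (x : E3)))
  obtain ⟨C, hC⟩ := ((isCompact_Icc (a := t₀ - 1) (b := t₀ + 1)).prod
    (isCompact_univ (X := S2))).exists_bound_of_continuousOn hdc.continuousOn
  obtain ⟨C₀, hC₀⟩ := isCompact_univ.exists_bound_of_continuousOn (hslice t₀).continuousOn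
  have hbound {C : ℝ} {x : S2} {z : F} (hz : ‖z‖ ≤ C) : ‖⟪w x, z⟫‖ ≤ ‖w x‖ * C :=
    (norm_inner_le_norm _ _).trans (mul_le_mul_of_nonneg_left hz (norm_nonneg _))
  refine (hasDerivAt_integral_of_dominated_loc_of_deriv_le
    (Icc_mem_nhds (sub_one_lt t₀) (lt_add_one t₀))
    (F' := fun t x => ⟪w x, fderiv ℝ H (t, (x : E3)) (1, 0)⟫) (bound := fun x => ‖w x‖ * C)
    (.of_forall fun t => hw.1.inner (hslice t).aestronglyMeasurable) ?_
    (hw.1.inner (hdslice t₀).aestronglyMeasurable)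
    (.of_forall fun x t ht => hbound (hC (t, x) ⟨ht, mem_univ x⟩)) (hw.norm.mul_const C)
    (.of_forall fun x t _ => ?_)).2
  · exact (hw.norm.mul_const C₀).mono' (hw.1.inner (hslice t₀).aestronglyMeasurable)
      (.of_forall fun x => hbound (hC₀ x (mem_univ x)))
  · simpa using (hasDerivAt_const t (w x)).inner ℝ (hder t x)

lemma hasDerivAt_integral_mul {w : S2 → ℝ} (hw : Integrable w omega) {H : ℝ × E3 → ℝ}
    (hH : ∀ p : ℝ × E3, p.2 ≠ 0 → ContDiffAt ℝ 1 H p) (t₀ : ℝ) :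
    HasDerivAt (fun t => ∫ x, w x * H (t, (x : E3)) ∂omega)
      (∫ x, w x * fderiv ℝ H (t₀, (x : E3)) (1, 0) ∂omega) t₀ := by
  simpa [mul_comm] using hasDerivAt_integral_inner hw hH t₀

section Family

variable {γ : ℝ → S2 → ℝ}

/-- The velocity at time zero of a family of functions on the sphere. -/
noncomputable def velocity (γ : ℝ → S2 → ℝ) (x : S2) : ℝ := deriv (fun t => γ t x) 0

/-- The extension of a family of functions on the sphere that is constant along rays. -/
noncomputable def familyExt (γ : ℝ → S2 → ℝ) (p : ℝ × E3) : ℝ := γ p.1 (radialProj p.2)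

lemma familyExt_coe (γ : ℝ → S2 → ℝ) (t : ℝ) (x : S2) : familyExt γ (t, (x : E3)) = γ t x := by
  simp [familyExt]

/-- The Euclidean gradient in space of the extension of a family. -/
noncomputable def familyGrad (γ : ℝ → S2 → ℝ) (p : ℝ × E3) : E3 :=
  (InnerProductSpace.toDual ℝ E3).symm
    ((fderiv ℝ (familyExt γ) p).comp (ContinuousLinearMap.inr ℝ ℝ E3))

lemma inner_familyGrad (γ : ℝ → S2 → ℝ) (p : ℝ × E3) (v : E3) :
    ⟪familyGrad γ p, v⟫ = fderiv ℝ (familyExt γ) p (0, v) := by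
  rw [familyGrad, InnerProductSpace.toDual_symm_apply]
  simp

lemma contDiffAt_familyExt
    (hγ : ContMDiff (𝓘(ℝ, ℝ).prod (𝓡 2)) 𝓘(ℝ, ℝ) ∞ (fun p : ℝ × S2 => γ p.1 p.2))
    {p : ℝ × E3} (hp : p.2 ≠ 0) : ContDiffAt ℝ ∞ (familyExt γ) p :=
  contDiffAt_radialProj_family hγ hp

lemma contDiffAt_familyGrad
    (hγ : ContMDiff (𝓘(ℝ, ℝ).prod (𝓡 2)) 𝓘(ℝ, ℝ) ∞ (fun p : ℝ × S2 => γ p.1 p.2))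
    {p : ℝ × E3} (hp : p.2 ≠ 0) : ContDiffAt ℝ 1 (familyGrad γ) p := by
  have h1 : ContDiffAt ℝ 1 (fderiv ℝ (familyExt γ)) p :=
    (contDiffAt_familyExt hγ hp).fderiv_right (by norm_cast)
  exact (InnerProductSpace.toDual ℝ E3).symm.contDiff.contDiffAt.comp p
    (h1.clm_comp contDiffAt_const)

lemma contMDiff_slice
    (hγ : ContMDiff (𝓘(ℝ, ℝ).prod (𝓡 2)) 𝓘(ℝ, ℝ) ∞ (fun p : ℝ × S2 => γ p.1 p.2)) (t : ℝ) :
    ContMDiff (𝓡 2) 𝓘(ℝ, ℝ) ∞ (γ t) :=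
  hγ.comp (contMDiff_const.prodMk contMDiff_id)

lemma familyGrad_coe
    (hγ : ContMDiff (𝓘(ℝ, ℝ).prod (𝓡 2)) 𝓘(ℝ, ℝ) ∞ (fun p : ℝ × S2 => γ p.1 p.2))
    (t : ℝ) (x : S2) : familyGrad γ (t, (x : E3)) = sphGrad (γ t) x := by
  have hx : (x : E3) ≠ 0 := ne_zero_of_mem_unit_sphere x
  refine ext_inner_right ℝ fun v => ?_
  rw [inner_familyGrad, inner_sphGrad, (radialExt_eventuallyEq (γ t) hx).fderiv_eq]
  have h1 : HasFDerivAt (familyExt γ) _ (t, (x : E3)) :=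
    ((contDiffAt_familyExt hγ (p := (t, (x : E3))) hx).differentiableAt (by simp)).hasFDerivAt
  have h2 : HasFDerivAt (fun y => γ t (radialProj y)) _ (x : E3) :=
    h1.comp (x : E3) (hasFDerivAt_prodMk_right t (x : E3))
  rw [h2.fderiv]
  simp

lemma fderiv_familyExt_time
    (hγ : ContMDiff (𝓘(ℝ, ℝ).prod (𝓡 2)) 𝓘(ℝ, ℝ) ∞ (fun p : ℝ × S2 => γ p.1 p.2))
    {y : E3} (hy : y ≠ 0) :
    fderiv ℝ (familyExt γ) (0, y) (1, 0) = velocity γ (radialProj y) := by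
  have h1 : HasFDerivAt (familyExt γ) _ ((0 : ℝ), y) :=
    ((contDiffAt_familyExt hγ (p := ((0 : ℝ), y)) hy).differentiableAt (by simp)).hasFDerivAt
  have h2 : HasDerivAt (fun t => γ t (radialProj y)) _ 0 :=
    h1.comp_hasDerivAt (f := fun t : ℝ => (t, y)) 0
      ((hasDerivAt_id (0 : ℝ)).prodMk (hasDerivAt_const (0 : ℝ) y))
  exact h2.deriv.symm

lemma fderiv_familyExt_time_coe
    (hγ : ContMDiff (𝓘(ℝ, ℝ).prod (𝓡 2)) 𝓘(ℝ, ℝ) ∞ (fun p : ℝ × S2 => γ p.1 p.2)) (x : S2) :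
    fderiv ℝ (familyExt γ) (0, (x : E3)) (1, 0) = velocity γ x := by
  rw [fderiv_familyExt_time hγ (ne_zero_of_mem_unit_sphere x), radialProj_coe]

lemma isSmooth_velocity
    (hγ : ContMDiff (𝓘(ℝ, ℝ).prod (𝓡 2)) 𝓘(ℝ, ℝ) ∞ (fun p : ℝ × S2 => γ p.1 p.2)) :
    IsSmooth (velocity γ) := by
  have h1 : ContMDiff (𝓡 2) 𝓘(ℝ, ℝ) ∞
      (fun x : S2 => fderiv ℝ (familyExt γ) (0, (x : E3)) (1, 0)) := by
    refine contMDiff_comp_coe_sphere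
      (f := fun y : E3 => fderiv ℝ (familyExt γ) (0, y) (1, 0)) fun y hy => ?_
    have h2 : ContDiffAt ℝ ∞ (fderiv ℝ (familyExt γ)) ((0 : ℝ), y) :=
      (contDiffAt_familyExt hγ (p := ((0 : ℝ), y)) hy).fderiv_right (by norm_cast)
    exact (h2.comp y (contDiffAt_const.prodMk contDiffAt_id)).clm_apply contDiffAt_const
  exact (funext (fderiv_familyExt_time_coe hγ)) ▸ h1

/-- The time derivative of the gradients is the gradient of the velocity, by symmetry of second
derivatives. -/
lemma fderiv_familyGrad_time
    (hγ : ContMDiff (𝓘(ℝ, ℝ).prod (𝓡 2)) 𝓘(ℝ, ℝ) ∞ (fun p : ℝ × S2 => γ p.1 p.2)) (x : S2) :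
    fderiv ℝ (familyGrad γ) (0, (x : E3)) (1, 0) = sphGrad (velocity γ) x := by
  have hx : (x : E3) ≠ 0 := ne_zero_of_mem_unit_sphere x
  have hC := contDiffAt_familyExt hγ (p := ((0 : ℝ), (x : E3))) hx
  have hd2 : HasFDerivAt (fderiv ℝ (familyExt γ)) _ ((0 : ℝ), (x : E3)) :=
    ((hC.fderiv_right (m := 1) (by norm_cast)).differentiableAt one_ne_zero).hasFDerivAt
  have hg : HasFDerivAt (familyGrad γ) _ ((0 : ℝ), (x : E3)) :=
    ((contDiffAt_familyGrad hγ (p := ((0 : ℝ), (x : E3))) hx).differentiableAt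
      one_ne_zero).hasFDerivAt
  refine ext_inner_right ℝ fun v => ?_
  have hL : ⟪fderiv ℝ (familyGrad γ) (0, (x : E3)) (1, 0), v⟫ =
      fderiv ℝ (fderiv ℝ (familyExt γ)) (0, (x : E3)) (1, 0) (0, v) := by
    have h1 := hg.inner ℝ (hasFDerivAt_const v ((0 : ℝ), (x : E3)))
    simp_rw [inner_familyGrad] at h1
    have h2 := hd2.clm_apply (hasFDerivAt_const ((0 : ℝ), v) ((0 : ℝ), (x : E3)))
    have h3 := congrArg (fun L => L (1, 0)) (h1.unique h2)
    simpa using h3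
  have hR : ⟪sphGrad (velocity γ) x, v⟫ =
      fderiv ℝ (fderiv ℝ (familyExt γ)) (0, (x : E3)) (0, v) (1, 0) := by
    have h1 : radialExt (velocity γ) =ᶠ[nhds (x : E3)]
        fun y => fderiv ℝ (familyExt γ) (0, y) (1, 0) := by
      filter_upwards [isOpen_ne.mem_nhds hx] with y hy
      rw [radialExt_eq _ hy, fderiv_familyExt_time hγ hy]
    have h2 := (hd2.comp (x : E3) (hasFDerivAt_prodMk_right (0 : ℝ) (x : E3))).clm_apply
      (hasFDerivAt_const ((1 : ℝ), (0 : E3)) (x : E3))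
    have h3 : fderiv ℝ (fun y : E3 => fderiv ℝ (familyExt γ) (0, y) (1, 0)) (x : E3) = _ :=
      h2.fderiv
    rw [inner_sphGrad, h1.fderiv_eq, h3]
    simp
  rw [hL, hR]
  exact hC.isSymmSndFDerivAt (by simp; norm_cast) _ _

end Family

/-! ### The first variation -/

section Variation

variable {u : S2 → ℝ} {γ : ℝ → S2 → ℝ}

lemma IsVariationInH.mem_classH (hγ : IsVariationInH u γ) : u ∈ classH := by
  simpa [hγ.zero] using hγ.mem 0

lemma hasDerivAt_integral_exp_mul (hγ : IsVariationInH u γ) {f : S2 → ℝ} (hf : Continuous f) :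
    HasDerivAt (fun t => ∫ x, Real.exp (2 * (u x + γ t x)) * f x ∂omega)
      (2 * ∫ x, Real.exp (2 * u x) * f x * velocity γ x ∂omega) 0 := by
  have hw := (integrable_exp_of_mem_classH hγ.mem_classH).mul_continuous hf
  have hC {p : ℝ × E3} (hp : p.2 ≠ 0) : ContDiffAt ℝ 1 (familyExt γ) p :=
    (contDiffAt_familyExt hγ.smooth hp).of_le (by norm_cast)
  have h := hasDerivAt_integral_mul hw (H := fun p => Real.exp (2 * familyExt γ p))
    (fun p hp => (contDiffAt_const.mul (hC hp)).exp) 0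
  convert h using 1
  · ext1 t
    refine integral_congr_ae (.of_forall fun x => ?_)
    simp only
    rw [familyExt_coe, mul_add, Real.exp_add]
    ring
  · rw [← integral_const_mul]
    refine integral_congr_ae (.of_forall fun x => ?_)
    have h1 : HasFDerivAt (fun p => Real.exp (2 * familyExt γ p)) _ ((0 : ℝ), (x : E3)) :=
      ((((hC (p := ((0 : ℝ), (x : E3))) (ne_zero_of_mem_unit_sphere x)).differentiableAt
        one_ne_zero).hasFDerivAt).const_mul 2).exp
    simp only
    rw [h1.fderiv]
    simp only [smul_apply, smul_eq_mul, fderiv_familyExt_time_coe hγ.smooth, familyExt_coe,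
      hγ.zero]
    simp
    ring

/-- The normalization `∫ e^{2u + 2γ} = 1`, differentiated at time zero. -/
lemma IsVariationInH.integral_exp_mul_velocity (hγ : IsVariationInH u γ) :
    ∫ x, Real.exp (2 * u x) * velocity γ x ∂omega = 0 := by
  have h1 := hasDerivAt_integral_exp_mul hγ (f := fun _ => 1) continuous_const
  simp only [mul_one, (hγ.mem _).2] at h1
  have h2 := h1.unique (hasDerivAt_const (0 : ℝ) (1 : ℝ))
  linarith

lemma hasDerivAt_integral_add (hγ : IsVariationInH u γ) :
    HasDerivAt (fun t => ∫ x, (u x + γ t x) ∂omega) (∫ x, velocity γ x ∂omega) 0 := by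
  have hu : Integrable u omega := hγ.mem_classH.1.1.integrable one_le_two
  have h := hasDerivAt_integral_mul (integrable_const (1 : ℝ)) (H := familyExt γ)
    (fun p hp => (contDiffAt_familyExt hγ.smooth hp).of_le (by norm_cast)) 0
  simp only [familyExt_coe, one_mul, fderiv_familyExt_time_coe hγ.smooth] at h
  refine (h.const_add (∫ x, u x ∂omega)).congr_of_eventuallyEq (.of_forall fun t => ?_)
  exact integral_add hu (contMDiff_slice hγ.smooth t).continuous.integrable_omega

/-- The weak gradient along the variation is `∇u + ∇γ`; of the two terms that depend on time, only the
one linear in `∇γ` contributes at time zero, because `γ` vanishes there. -/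
lemma hasDerivAt_dirichlet (hγ : IsVariationInH u γ) :
    HasDerivAt (fun t => ∫ x, ‖weakGrad (fun x => u x + γ t x) x‖ ^ 2 ∂omega)
      (2 * ∫ x, ⟪weakGrad u x, sphGrad (velocity γ) x⟫ ∂omega) 0 := by
  have hu : MemH1 u := hγ.mem_classH.1
  have hG : MemLp (weakGrad u) 2 omega := (isWeakGrad_weakGrad hu.2).memLp
  have hs (t : ℝ) : ContMDiff (𝓡 2) 𝓘(ℝ, ℝ) 1 (γ t) :=
    (contMDiff_slice hγ.smooth t).of_le (by norm_cast)
  have h1 := hasDerivAt_integral_inner (hG.integrable one_le_two)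
    (fun p hp => contDiffAt_familyGrad hγ.smooth hp) 0
  have h2 := hasDerivAt_integral_mul (integrable_const (1 : ℝ))
    (H := fun p => ‖familyGrad γ p‖ ^ 2)
    (fun p hp => (contDiffAt_familyGrad hγ.smooth hp).norm_sq ℝ) 0
  have h0 (x : S2) : familyGrad γ (0, (x : E3)) = 0 := by
    have hz : radialExt (γ 0) = fun _ => 0 := by
      ext1 y
      by_cases hy : y = 0
      · simp [radialExt, hy]
      · rw [radialExt_eq _ hy, hγ.zero]
    rw [familyGrad_coe hγ.smooth, sphGrad, hz, gradient_fun_const]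
  have h3 (x : S2) : fderiv ℝ (fun p => ‖familyGrad γ p‖ ^ 2) (0, (x : E3)) (1, 0) = 0 := by
    have h4 : HasFDerivAt (fun p => ‖familyGrad γ p‖ ^ 2) _ ((0 : ℝ), (x : E3)) :=
      ((contDiffAt_familyGrad hγ.smooth (p := ((0 : ℝ), (x : E3)))
        (ne_zero_of_mem_unit_sphere x)).differentiableAt one_ne_zero).hasFDerivAt.norm_sq
    rw [h4.fderiv]
    simp [h0 x]
  simp only [h3, fderiv_familyGrad_time hγ.smooth, familyGrad_coe hγ.smooth, one_mul,
    integral_zero] at h1 h2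
  rw [← add_zero (2 * _)]
  refine (((h1.const_mul 2).add h2).const_add
    (∫ x, ‖weakGrad u x‖ ^ 2 ∂omega)).congr_of_eventuallyEq (.of_forall fun t => ?_)
  · have hgc := continuous_sphGrad (hs t)
    have hi1 : Integrable (fun x => ‖weakGrad u x‖ ^ 2) omega := hG.integrable_norm_pow two_ne_zero
    have hi2 : Integrable (fun x => 2 * ⟪weakGrad u x, sphGrad (γ t) x⟫) omega :=
      (hG.integrable_inner_continuous hgc).const_mul 2
    have hi3 : Integrable (fun x => ‖sphGrad (γ t) x‖ ^ 2) omega :=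
      (hgc.norm.pow 2).integrable_omega
    have hi12 : Integrable
      (fun x => ‖weakGrad u x‖ ^ 2 + 2 * ⟪weakGrad u x, sphGrad (γ t) x⟫) omega := hi1.add hi2
    calc ∫ x, ‖weakGrad (fun x => u x + γ t x) x‖ ^ 2 ∂omega
        = ∫ x, (‖weakGrad u x‖ ^ 2 + 2 * ⟪weakGrad u x, sphGrad (γ t) x⟫ +
            ‖sphGrad (γ t) x‖ ^ 2) ∂omega := by
          refine integral_congr_ae ?_
          filter_upwards [hu.weakGrad_add (hs t)] with x hx
          rw [hx, norm_add_sq_real]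
      _ = _ := by
          rw [integral_add hi12 hi3, integral_add hi1 hi2, integral_const_mul, add_assoc]
          rfl

/-- The first variation of `I_α` is `-2` times the weak form of the equation. -/
lemma hasDerivAt_functionalI (α : ℝ) (hγ : IsVariationInH u γ) :
    HasDerivAt (fun t => functionalI α (fun x => u x + γ t x))
      (-2 * weakForm α u (velocity γ)) 0 := by
  have hA : 1 - ∑ i, moment u i ^ 2 ≠ 0 :=
    (sub_pos.2 (sum_moment_sq_lt_one hγ.mem_classH)).ne'
  have hm (i : Fin 3) := hasDerivAt_integral_exp_mul hγ (continuous_coord i)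
  have hlog := ((HasDerivAt.fun_sum (u := Finset.univ) fun i _ => (hm i).pow 2).const_sub 1).log
    (by simpa [hγ.zero, moment] using hA)
  have h := (((hasDerivAt_dirichlet hγ).const_mul α).add
    ((hasDerivAt_integral_add hγ).const_mul 2)).sub (hlog.const_mul (1 / 2))
  have hvel : Continuous (velocity γ) := (isSmooth_velocity hγ.smooth).continuous
  refine (h.congr_of_eventuallyEq (.of_forall fun t => ?_)).congr_deriv ?_
  · simp [functionalI, moment, (hγ.mem t).2]
  · have hsum : ∑ i, 2 * moment u i *
        (2 * ∫ x, Real.exp (2 * u x) * (x : E3) i * velocity γ x ∂omega) =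
        4 * ∑ i, moment u i * ∫ x, Real.exp (2 * u x) * (x : E3) i * velocity γ x ∂omega := by
      rw [Finset.mul_sum]
      exact Finset.sum_congr rfl fun i _ => by ring
    have hmom (i : Fin 3) : ∫ x, Real.exp (2 * u x) * (x : E3) i ∂omega = moment u i := rfl
    simp only [weakForm]
    rw [integral_eulerTerm_mul hγ.mem_classH hvel, hγ.integral_exp_mul_velocity]
    simp only [hγ.zero, add_zero, Pi.pow_apply, Nat.cast_ofNat, Nat.add_one_sub_one, pow_one,
      hmom, hsum]
    field_simp
    ring

end Variation

/-! ### Variations with prescribed velocity -/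

section Existence

variable {u φ : S2 → ℝ}

/-- The constant `½ log ∫ e^{2u + 2tφ}`, whose subtraction brings `u + t φ` back into `𝓗`. -/
noncomputable def normalization (u φ : S2 → ℝ) (t : ℝ) : ℝ :=
  Real.log (∫ x, Real.exp (2 * u x) * Real.exp (t * (2 * φ x)) ∂omega) / 2

/-- The normalization is smooth in time although `u` may be unbounded. -/
lemma contDiff_normalization (hu : u ∈ classH) (hφ : Continuous φ) :
    ContDiff ℝ ∞ (normalization u φ) := by
  have hint := integrable_exp_of_mem_classH hu
  -- Up to the factor `1 / 2` this is the cumulant generating function of `2 φ` under `e^{2u} dω`.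
  let ν : Measure S2 := omega.tilted fun x => 2 * u x
  have : IsProbabilityMeasure ν := isProbabilityMeasure_tilted hint
  have hexp : ProbabilityTheory.integrableExpSet (fun x => 2 * φ x) ν = univ := by
    refine eq_univ_of_forall fun t => ?_
    have hc : Continuous fun x => Real.exp (t * (2 * φ x)) := by fun_prop
    obtain ⟨C, hC⟩ := isCompact_univ.exists_bound_of_continuousOn hc.continuousOn
    exact Integrable.of_bound hc.aestronglyMeasurable C (.of_forall fun x => hC x (mem_univ x))
  have heq : normalization u φ = fun t => ProbabilityTheory.cgf (fun x => 2 * φ x) ν t / 2 := by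
    ext1 t
    rw [normalization, ProbabilityTheory.cgf, ProbabilityTheory.mgf, integral_tilted]
    simp [hu.2]
  rw [heq, contDiff_iff_contDiffAt]
  intro t
  exact (ProbabilityTheory.analyticAt_cgf (by simp [hexp])).contDiffAt.div_const 2

/-- Every smooth function generates a variation inside `𝓗`, after normalization by a function of
time only. -/
lemma isVariationInH_normalized (hu : u ∈ classH) (hφ : IsSmooth φ) :
    IsVariationInH u fun t x => t * φ x - normalization u φ t where
  smooth := by
    have hφ' : ContMDiff (𝓡 2) 𝓘(ℝ, ℝ) ∞ φ := hφ
    have hn := (contDiff_normalization hu hφ.continuous).contMDiff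
    exact (contMDiff_fst.mul (hφ'.comp contMDiff_snd)).sub (hn.comp contMDiff_fst)
  zero x := by simp [normalization, hu.2]
  mem t := by
    have hφ' : ContMDiff (𝓡 2) 𝓘(ℝ, ℝ) 1 φ := ContMDiff.of_le hφ (by norm_cast)
    refine ⟨hu.1.add (γ := fun x => t * φ x - normalization u φ t)
      ((contMDiff_const.mul hφ').sub contMDiff_const), ?_⟩
    have hφc : Continuous φ := hφ.continuous
    have hi : Integrable (fun x => Real.exp (2 * u x) * Real.exp (t * (2 * φ x))) omega :=
      (integrable_exp_of_mem_classH hu).mul_continuous (by fun_prop)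
    have hpos : 0 < ∫ x, Real.exp (2 * u x) * Real.exp (t * (2 * φ x)) ∂omega := by
      simp_rw [← Real.exp_add] at hi ⊢
      exact integral_exp_pos hi
    have h1 (x : S2) : Real.exp (2 * (u x + (t * φ x - normalization u φ t))) =
        Real.exp (2 * u x) * Real.exp (t * (2 * φ x)) *
          (∫ x, Real.exp (2 * u x) * Real.exp (t * (2 * φ x)) ∂omega)⁻¹ := by
      have h2 : Real.exp (2 * normalization u φ t) =
          ∫ x, Real.exp (2 * u x) * Real.exp (t * (2 * φ x)) ∂omega := by
        rw [normalization, mul_div_cancel₀ _ two_ne_zero, Real.exp_log hpos]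
      rw [← h2, ← Real.exp_neg, ← Real.exp_add, ← Real.exp_add]
      congr 1
      ring
    simp_rw [h1]
    rw [integral_mul_const, mul_inv_cancel₀ hpos.ne']

lemma velocity_normalized (hu : u ∈ classH) (hφ : Continuous φ) (x : S2) :
    velocity (fun t x => t * φ x - normalization u φ t) x =
      φ x - deriv (normalization u φ) 0 := by
  have h1 : HasDerivAt (normalization u φ) _ 0 :=
    ((contDiff_normalization hu hφ).differentiable (by simp) 0).hasDerivAt
  have h2 : HasDerivAt (fun t : ℝ => t * φ x) (φ x) 0 := by
    simpa using (hasDerivAt_id (0 : ℝ)).mul_const (φ x)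
  exact (h2.sub h1).deriv

/-- Constants are in the kernel of the weak form, since `∫ e^{2u} (1 - ∑ a_i x_i) = 1 - ∑ a_i²`. -/
lemma weakForm_sub_const (α : ℝ) (hu : u ∈ classH) (hφ : IsSmooth φ) (c : ℝ) :
    weakForm α u (fun x => φ x - c) = weakForm α u φ := by
  have hA : 1 - ∑ i, moment u i ^ 2 ≠ 0 := (sub_pos.2 (sum_moment_sq_lt_one hu)).ne'
  have hφc : Continuous φ := hφ.continuous
  have hgrad (x : S2) : sphGrad (fun x => φ x - c) x = sphGrad φ x := by
    have h1 : radialExt (fun x => φ x - c) =ᶠ[nhds (x : E3)] fun y => radialExt φ y - c := by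
      filter_upwards [isOpen_ne.mem_nhds (ne_zero_of_mem_unit_sphere x)] with y hy
      rw [radialExt_eq _ hy, radialExt_eq _ hy]
    rw [sphGrad, sphGrad, gradient, gradient, h1.fderiv_eq, fderiv_sub_const]
  have hone : ∫ x, eulerTerm u x * 1 ∂omega = 0 := by
    rw [integral_eulerTerm_mul hu continuous_const]
    have h2 : ∑ i, moment u i * ∫ x : S2, Real.exp (2 * u x) * (x : E3) i * 1 ∂omega =
        ∑ i, moment u i ^ 2 := by
      refine Finset.sum_congr rfl fun i _ => ?_
      simp only [mul_one, sq, moment]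
    rw [h2]
    simp only [mul_one, hu.2]
    rw [inv_mul_cancel₀ hA]
    simp
  have hsub (x : S2) : eulerTerm u x * (φ x - c) =
      eulerTerm u x * φ x - c * (eulerTerm u x * 1) := by
    ring
  simp only [weakForm, hgrad, hsub]
  rw [integral_sub (integrable_eulerTerm_mul hu hφc)
    ((integrable_eulerTerm_mul hu continuous_const).const_mul c), integral_const_mul, hone,
    mul_zero, sub_zero]

end Existence

/-! ### Critical points, weak solutions and classical solutions -/

/-- For functions of class `C²` the weak form is the pairing with the pointwise equation. -/
lemma weakForm_eq_integral (α : ℝ) {u φ : S2 → ℝ} (hu : u ∈ classH)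
    (hu2 : ContMDiff (𝓡 2) 𝓘(ℝ, ℝ) 2 u) (hφ : IsSmooth φ) :
    weakForm α u φ = ∫ x, φ x • (α * sphLaplacian u x + eulerTerm u x) ∂omega := by
  have hφ1 : ContMDiff (𝓡 2) 𝓘(ℝ, ℝ) 1 φ := ContMDiff.of_le hφ (by norm_cast)
  have hgrad : weakGrad u =ᵐ[omega] sphGrad u :=
    (isWeakGrad_weakGrad hu.1.2).ae_eq (isWeakGrad_sphGrad (hu2.of_le one_le_two))
  have h1 : ∫ x, ⟪weakGrad u x, sphGrad φ x⟫ ∂omega = -∫ x, sphLaplacian u x * φ x ∂omega := by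
    rw [← integral_inner_sphGrad_sphGrad hu2 hφ1]
    refine integral_congr_ae ?_
    filter_upwards [hgrad] with x hx
    rw [hx]
  have h2 (x : S2) : φ x • (α * sphLaplacian u x + eulerTerm u x) =
      α * (sphLaplacian u x * φ x) + eulerTerm u x * φ x := by
    rw [smul_eq_mul]
    ring
  have hi : Integrable (fun x => sphLaplacian u x * φ x) omega :=
    ((continuous_sphLaplacian hu2).mul hφ1.continuous).integrable_omega
  simp_rw [h2]
  rw [integral_add (hi.const_mul α) (integrable_eulerTerm_mul hu hφ1.continuous),
    integral_const_mul, weakForm, h1]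
  ring

lemma continuous_eulerTerm {u : S2 → ℝ} (hu : Continuous u) : Continuous (eulerTerm u) := by
  unfold eulerTerm
  fun_prop

lemma isWeakSolution_iff_isClassicalSolution (α : ℝ) {u : S2 → ℝ} (hu : u ∈ classH)
    (hu2 : ContMDiff (𝓡 2) 𝓘(ℝ, ℝ) 2 u) : IsWeakSolution α u ↔ IsClassicalSolution α u := by
  have hc : Continuous fun x => α * sphLaplacian u x + eulerTerm u x :=
    (continuous_const.mul (continuous_sphLaplacian hu2)).add (continuous_eulerTerm hu2.continuous)
  constructor
  · intro h
    have hae := ae_eq_zero_of_integral_contMDiff_smul_eq_zero (𝓡 2)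
      hc.integrable_omega.locallyIntegrable
      fun g hg _ => (weakForm_eq_integral α hu hu2 hg).symm.trans (h g hg)
    exact congrFun ((hc.ae_eq_iff_eq omega continuous_const).1 hae)
  · intro h φ hφ
    refine (weakForm_eq_integral α hu hu2 hφ).trans ?_
    simp [h _]

lemma isCriticalInH_iff_isWeakSolution (α : ℝ) {u : S2 → ℝ} (hu : u ∈ classH) :
    IsCriticalInH α u ↔ IsWeakSolution α u := by
  constructor
  · intro h φ hφ
    have hγ := isVariationInH_normalized hu hφ
    have h1 := (hasDerivAt_functionalI α hγ).unique (h _ hγ)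
    rw [funext (velocity_normalized hu hφ.continuous), weakForm_sub_const α hu hφ] at h1
    exact (mul_eq_zero.1 h1).resolve_left (by norm_num)
  · intro h γ hγ
    have h1 : weakForm α u (velocity γ) = 0 := h _ (isSmooth_velocity hγ.smooth)
    simpa [h1] using hasDerivAt_functionalI α hγ

theorem mainTheorem10 (α : ℝ) (hα : 0 < α) (u : S2 → ℝ) (hu : u ∈ classH) :
    ∑ i, moment u i ^ 2 < 1 ∧
    (IsCriticalInH α u ↔ IsWeakSolution α u) ∧
    (ContMDiff (𝓡 2) 𝓘(ℝ, ℝ) 2 u → (IsCriticalInH α u ↔ IsClassicalSolution α u)) :=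
  ⟨sum_moment_sq_lt_one hu, isCriticalInH_iff_isWeakSolution α hu, fun hu2 =>
    (isCriticalInH_iff_isWeakSolution α hu).trans
      (isWeakSolution_iff_isClassicalSolution α hu hu2)⟩
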